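/- On $M=\mathbb{R}^2$ let $v_1 = x\frac{\partial}{\partial x}+y\frac{\partial}{\partial y}$ and $v_2=-y\frac{\partial}{\partial x}+x\frac{\partial}{\partial y}$, let $E\subseteq \mathrm{Vect}(\mathbb{R}^2)$ be the (free, involutive) $C^\infty(\mathbb{R}^2)$-submodule generated by $v_1$ and $v_2$, and let $\Pi_E = v_1\wedge v_2=(x^2+y^2)\frac{\partial}{\partial x}\wedge\frac{\partial}{\partial y}$ be the associated Poisson structure. Let ${}^E H^\ast(\mathbb{R}^2)$ be the $E$-cohomology, i.e. the cohomology of the complex of $E$-forms (alternating $C^\infty(\mathbb{R}^2)$-multilinear maps $E\times\dots\times E\to C^\infty(\mathbb{R}^2)$) with the differential $$d\omega(V_0,\dots,V_p)=\sum_i(-1)^iV_i\bigl(\omega(V_0,\dots,\hat V_i,\dots,V_p)\bigr)+\sum_{i<j}(-1)^{i+j}\omega([V_i,V_j],V_0,\dots,\hat V_i,\dots,\hat V_j,\dots,V_p),$$ and let $H^\ast_{\Pi_E}(\mathbb{R}^2)$ be the Poisson cohomology, i.e. the cohomology of the complex of multivector fields on $\mathbb{R}^2$ with differential $[\Pi_E,\cdot]$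 (Schouten bracket). Then, as real vector spaces, $${}^E H^2(\mathbb{R}^2)\cong\mathbb{R},\qquad H^2_{\Pi_E}(\mathbb{R}^2)\cong\mathbb{R}^2 .$$ In particular ${}^E H^2(\mathbb{R}^2)\not\cong H^2_{\Pi_E}(\mathbb{R}^2)$, so the $E$-cohomology is not isomorphic to the Poisson cohomology as a graded real vector space. -/

import Mathlib

noncomputable section

/-! ### The Koszul formula

For a bracket `br` on `L` and an action `act` of `L` on `M`, the differential of a `p`-cochain
`ω` is
`dω(V₀, …, V_p) = ∑ᵢ (-1)ⁱ Vᵢ(ω(V₀, …, V̂ᵢ, …, V_p))`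
`    + ∑_{i < j} (-1)^(i+j) ω([Vᵢ, Vⱼ], V₀, …, V̂ᵢ, …, V̂ⱼ, …, V_p)`. -/

/-- The first sum in the Koszul formula. -/
def koszulAction {L M : Type*} [AddCommGroup M] (act : L → M → M) {p : ℕ}
    (ω : (Fin p → L) → M) (V : Fin (p + 1) → L) : M :=
  ∑ i : Fin (p + 1), (-1 : ℤ) ^ (i : ℕ) • act (V i) (ω (i.removeNth V))

/-- The second sum in the Koszul formula; it is empty for `p = 0`. For `p = q + 1` the sum is over
the positions `i < j` in `Fin (q + 2)`; as `i` is not the last position, it is written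
`i.castSucc` with `i : Fin (q + 1)`, and this `i` is also its position once `V j` is removed. -/
def koszulBracket {L M : Type*} [AddCommGroup M] (br : L → L → L) :
    {p : ℕ} → ((Fin p → L) → M) → (Fin (p + 1) → L) → M
  | 0, _, _ => 0
  | q + 1, ω, V =>
    ∑ j : Fin (q + 2), ∑ i : Fin (q + 1),
      if i.castSucc < j then
        (-1 : ℤ) ^ ((i : ℕ) + (j : ℕ)) •
          ω (Fin.cons (br (V i.castSucc) (V j)) (i.removeNth (j.removeNth V)))
      else 0

/-- The Koszul formula. -/
def koszul {L M : Type*} [AddCommGroup M] (br : L → L → L) (act : L → M → M) {p : ℕ}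
    (ω : (Fin p → L) → M) (V : Fin (p + 1) → L) : M :=
  koszulAction act ω V + koszulBracket br ω V

theorem koszul_add {L M : Type*} [AddCommGroup M] (br : L → L → L) (act : L → M → M)
    (h : ∀ v a b, act v (a + b) = act v a + act v b) {p : ℕ} (ω η : (Fin p → L) → M) :
    koszul br act (ω + η) = koszul br act ω + koszul br act η := by
  funext V
  have h2 : koszulBracket br (ω + η) V = koszulBracket br ω V + koszulBracket br η V := by
    cases p with
    | zero => simp [koszulBracket]
    | succ q =>
      simp only [koszulBracket, ← Finset.sum_add_distrib]
      refine Finset.sum_congr rfl fun j _ => Finset.sum_congr rfl fun i _ => ?_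
      split_ifs <;> simp
  have h1 : koszulAction act (ω + η) V = koszulAction act ω V + koszulAction act η V := by
    simp only [koszulAction, ← Finset.sum_add_distrib, Pi.add_apply, h, smul_add]
  simp only [koszul, Pi.add_apply, h1, h2]
  abel

theorem koszul_smul {R L M : Type*} [CommRing R] [AddCommGroup M] [Module R M]
    (br : L → L → L) (act : L → M → M) (h : ∀ v (r : R) a, act v (r • a) = r • act v a)
    {p : ℕ} (r : R) (ω : (Fin p → L) → M) :
    koszul br act (r • ω) = r • koszul br act ω := by
  funext V
  have h2 : koszulBracket br (r • ω) V = r • koszulBracket br ω V := by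
    cases p with
    | zero => simp [koszulBracket]
    | succ q =>
      simp only [koszulBracket, Finset.smul_sum]
      refine Finset.sum_congr rfl fun j _ => Finset.sum_congr rfl fun i _ => ?_
      split_ifs
      · simp only [Pi.smul_apply]; rw [smul_comm]
      · simp
  have h1 : koszulAction act (r • ω) V = r • koszulAction act ω V := by
    simp only [koszulAction, Finset.smul_sum, Pi.smul_apply, h]
    exact Finset.sum_congr rfl fun i _ => smul_comm _ _ _
  simp only [koszul, Pi.smul_apply, h1, h2, smul_add]

/-- The Koszul differential as a linear map on arbitrary `M`-valued functions of tuples. -/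
def koszulD {R L M : Type*} [CommRing R] [AddCommGroup M] [Module R M]
    (br : L → L → L) (act : L → M →ₗ[R] M) (p : ℕ) :
    ((Fin p → L) → M) →ₗ[R] ((Fin (p + 1) → L) → M) where
  toFun ω := koszul br (fun v a => act v a) ω
  map_add' ω η := koszul_add _ _ (by simp) ω η
  map_smul' r ω := koszul_smul _ _ (by simp) r ω

section Cohomology

variable {R : Type*} [CommRing R] {C : ℕ → Type*} [∀ p, AddCommGroup (C p)] [∀ p, Module R (C p)]

/-- The cocycles of degree `p` in the graded subspace `Ω` of `C`. -/
def cocycles (d : ∀ p, C p →ₗ[R] C (p + 1)) (Ω : ∀ p, Submodule R (C p)) (p : ℕ) :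
    Submodule R (C p) :=
  Ω p ⊓ LinearMap.ker (d p)

/-- The coboundaries of degree `p` in the graded subspace `Ω` of `C`. -/
def coboundaries (d : ∀ p, C p →ₗ[R] C (p + 1)) (Ω : ∀ p, Submodule R (C p)) :
    (p : ℕ) → Submodule R (C p)
  | 0 => ⊥
  | p + 1 => Ω (p + 1) ⊓ (Ω p).map (d p)

/-- The cohomology of `(Ω, d)` in degree `p`: cocycles modulo coboundaries. -/
abbrev cohomology (d : ∀ p, C p →ₗ[R] C (p + 1)) (Ω : ∀ p, Submodule R (C p)) (p : ℕ) : Type _ :=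
  cocycles d Ω p ⧸ (coboundaries d Ω p).submoduleOf (cocycles d Ω p)

end Cohomology

/-! ### `E`-forms and `E`-cohomology

`A` is the algebra of smooth functions, and vector fields are the derivations of `A`. An involutive
submodule `E` of the vector fields is a `LieRinehartSubalgebra A (Derivation ℝ A A)`: a
sub-`A`-module closed under the Lie bracket of vector fields. -/

section ECohomology

variable {A : Type*} [CommRing A] [Algebra ℝ A]

/-- `E`-forms of degree `p`: alternating `A`-multilinear maps `E × ⋯ × E → A`. When `E` is locally
free, with `E`-tangent bundle `ᴱTM`, these are the sections of `⋀ᵖ (ᴱTM)*`. -/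
def EForm (E : LieRinehartSubalgebra A (Derivation ℝ A A)) (p : ℕ) :
    Submodule ℝ ((Fin p → E) → A) where
  carrier := {ω | ∃ α : E [⋀^Fin p]→ₗ[A] A, ⇑α = ω}
  zero_mem' := ⟨0, rfl⟩
  add_mem' := by
    rintro _ _ ⟨α, rfl⟩ ⟨β, rfl⟩
    exact ⟨α + β, rfl⟩
  smul_mem' := by
    rintro r _ ⟨α, rfl⟩
    exact ⟨r • α, rfl⟩

/-- The differential of `E`-forms: the Koszul formula for the Lie bracket of vector fields and the
action of vector fields on functions. -/
def EForm.d (E : LieRinehartSubalgebra A (Derivation ℝ A A)) (p : ℕ) :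
    ((Fin p → E) → A) →ₗ[ℝ] ((Fin (p + 1) → E) → A) :=
  koszulD (fun V W : E => ⁅V, W⁆) (fun V : E => ((V : Derivation ℝ A A) : A →ₗ[ℝ] A)) p

/-- `E`-cohomology in degree `p`. -/
abbrev ECohomology (E : LieRinehartSubalgebra A (Derivation ℝ A A)) (p : ℕ) : Type _ :=
  cohomology (EForm.d E) (EForm E) p

end ECohomology

/-! ### Poisson cohomology -/

section PoissonCohomology

variable {A : Type*} [CommRing A] [Algebra ℝ A]

/-- A Poisson structure on `A`: a Lie bracket that is a derivation in each argument. -/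
structure PoissonStructure (A : Type*) [CommRing A] [Algebra ℝ A] where
  bracket : A →ₗ[ℝ] A →ₗ[ℝ] A
  bracket_self : ∀ f, bracket f f = 0
  jacobi : ∀ f g h,
    bracket f (bracket g h) + bracket g (bracket h f) + bracket h (bracket f g) = 0
  leibniz : ∀ f g h, bracket f (g * h) = g * bracket f h + h * bracket f g

/-- Multivector fields of degree `p`: alternating `ℝ`-multilinear maps `A × ⋯ × A → A` that are
derivations in each argument, a section `P` of `⋀ᵖ TM` being the map
`(f₁, …, f_p) ↦ P(df₁, …, df_p)`. -/
def Multivector (A : Type*) [CommRing A] [Algebra ℝ A] (p : ℕ) :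
    Submodule ℝ ((Fin p → A) → A) where
  carrier := {P | (∃ Q : A [⋀^Fin p]→ₗ[ℝ] A, ⇑Q = P) ∧
    ∀ (F : Fin p → A) (i : Fin p) (g h : A),
      P (Function.update F i (g * h)) =
        g * P (Function.update F i h) + h * P (Function.update F i g)}
  zero_mem' := ⟨⟨0, rfl⟩, by simp⟩
  add_mem' := by
    rintro _ _ ⟨⟨P, rfl⟩, hP⟩ ⟨⟨Q, rfl⟩, hQ⟩
    refine ⟨⟨P + Q, rfl⟩, fun F i g h => ?_⟩
    simp only [Pi.add_apply, hP F i g h, hQ F i g h]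
    ring
  smul_mem' := by
    rintro r _ ⟨⟨P, rfl⟩, hP⟩
    refine ⟨⟨r • P, rfl⟩, fun F i g h => ?_⟩
    simp only [Pi.smul_apply, hP F i g h, smul_add, mul_smul_comm]

/-- The differential `P ↦ ± [Π, P]` on multivector fields (Schouten bracket with the Poisson
bivector), given by
`∑ᵢ (-1)ⁱ {fᵢ, P(f₀, …, f̂ᵢ, …, f_p)}`
`    + ∑_{i < j} (-1)^(i+j) P({fᵢ, fⱼ}, f₀, …, f̂ᵢ, …, f̂ⱼ, …, f_p)`. -/
def Multivector.d (π : PoissonStructure A) (p : ℕ) :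
    ((Fin p → A) → A) →ₗ[ℝ] ((Fin (p + 1) → A) → A) :=
  koszulD (fun f g => π.bracket f g) (fun f => π.bracket f) p

/-- Poisson cohomology in degree `p`. -/
abbrev PoissonCohomology (π : PoissonStructure A) (p : ℕ) : Type _ :=
  cohomology (Multivector.d π) (Multivector A) p

/-- The Poisson structure `v ∧ w`, i.e. `{f, g} = v(f) w(g) - w(f) v(g)`, for two commuting
vector fields `v`, `w`. -/
def PoissonStructure.wedge (v w : Derivation ℝ A A) (hvw : ∀ f, v (w f) = w (v f)) :
    PoissonStructure A where
  bracket := LinearMap.mk₂ ℝ (fun f g => v f * w g - w f * v g)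
    (by intros; simp; ring)
    (by intros; simp [smul_sub])
    (by intros; simp; ring)
    (by intros; simp [smul_sub])
  bracket_self f := by simp [mul_comm]
  jacobi f g h := by
    simp [hvw]
    ring
  leibniz f g h := by
    simp
    ring

end PoissonCohomology

/-! ### The elliptic structure on the plane -/

open scoped Manifold ContDiff

/-- Smooth functions on `ℝ²`. -/
abbrev SmoothPlane : Type := C^∞⟮𝓘(ℝ, ℝ × ℝ), ℝ × ℝ; ℝ⟯

namespace SmoothPlane

theorem contDiff (f : SmoothPlane) : ContDiff ℝ ∞ (f : ℝ × ℝ → ℝ) := f.contMDiff.contDiff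

theorem differentiableAt (f : SmoothPlane) (p : ℝ × ℝ) : DifferentiableAt ℝ (f : ℝ × ℝ → ℝ) p :=
  f.contDiff.differentiable (by simp) p

/-- The coordinate function `x`. -/
def x : SmoothPlane := ⟨fun p => p.1, contDiff_fst.contMDiff⟩

/-- The coordinate function `y`. -/
def y : SmoothPlane := ⟨fun p => p.2, contDiff_snd.contMDiff⟩

/-- The derivative in the constant direction `u`, as a vector field. -/
def dirDeriv (u : ℝ × ℝ) : Derivation ℝ SmoothPlane SmoothPlane :=
  Derivation.mk'
    { toFun := fun f => ⟨fun p => fderiv ℝ f p u,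
        ((f.contDiff.fderiv_right (m := ∞) (by simp)).clm_apply contDiff_const).contMDiff⟩
      map_add' := fun f g => by
        ext p
        change fderiv ℝ ((f : ℝ × ℝ → ℝ) + (g : ℝ × ℝ → ℝ)) p u = fderiv ℝ f p u + fderiv ℝ g p u
        rw [fderiv_add (f.differentiableAt p) (g.differentiableAt p)]
        rfl
      map_smul' := fun r f => by
        ext p
        change fderiv ℝ (r • (f : ℝ × ℝ → ℝ)) p u = r • fderiv ℝ f p u
        rw [fderiv_const_smul (f.differentiableAt p)]
        rfl }
    (fun f g => by
      ext p
      change fderiv ℝ ((f : ℝ × ℝ → ℝ) * (g : ℝ × ℝ → ℝ)) p u = f p * fderiv ℝ g p u + g p * fderiv ℝ f p u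
      rw [fderiv_mul (f.differentiableAt p) (g.differentiableAt p)]
      simp)

theorem dirDeriv_apply (u : ℝ × ℝ) (f : SmoothPlane) (p : ℝ × ℝ) :
    dirDeriv u f p = fderiv ℝ f p u := rfl

/-- `∂/∂x`. -/
def dx : Derivation ℝ SmoothPlane SmoothPlane := dirDeriv (1, 0)

/-- `∂/∂y`. -/
def dy : Derivation ℝ SmoothPlane SmoothPlane := dirDeriv (0, 1)

theorem dx_dy (f : SmoothPlane) : dx (dy f) = dy (dx f) := by
  ext p
  have h2 : DifferentiableAt ℝ (fderiv ℝ (f : ℝ × ℝ → ℝ)) p :=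
    (f.contDiff.fderiv_right (m := ∞) (by simp)).differentiable (by simp) p
  have hs : IsSymmSndFDerivAt ℝ (f : ℝ × ℝ → ℝ) p :=
    f.contDiff.contDiffAt.isSymmSndFDerivAt
      (by simpa using WithTop.coe_le_coe.2 (le_top : (2 : ℕ∞) ≤ ⊤))
  have key (u v : ℝ × ℝ) :
      dirDeriv u (dirDeriv v f) p = fderiv ℝ (fderiv ℝ (f : ℝ × ℝ → ℝ)) p u v := by
    change fderiv ℝ (fun q => fderiv ℝ (f : ℝ × ℝ → ℝ) q v) p u = _
    rw [fderiv_clm_apply h2 (differentiableAt_const v)]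
    simp
  change dirDeriv (1, 0) (dirDeriv (0, 1) f) p = dirDeriv (0, 1) (dirDeriv (1, 0) f) p
  rw [key, key]
  exact hs _ _

theorem dx_x : dx x = 1 := by
  ext p
  change fderiv ℝ (fun q : ℝ × ℝ => q.1) p (1, 0) = 1
  simp [fderiv_fst]

theorem dx_y : dx y = 0 := by
  ext p
  change fderiv ℝ (fun q : ℝ × ℝ => q.2) p (1, 0) = 0
  simp [fderiv_snd]

theorem dy_x : dy x = 0 := by
  ext p
  change fderiv ℝ (fun q : ℝ × ℝ => q.1) p (0, 1) = 0
  simp [fderiv_fst]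

theorem dy_y : dy y = 1 := by
  ext p
  change fderiv ℝ (fun q : ℝ × ℝ => q.2) p (0, 1) = 1
  simp [fderiv_snd]

/-- `v₁ = x ∂/∂x + y ∂/∂y`. -/
def v₁ : Derivation ℝ SmoothPlane SmoothPlane := x • dx + y • dy

/-- `v₂ = -y ∂/∂x + x ∂/∂y`. -/
def v₂ : Derivation ℝ SmoothPlane SmoothPlane := -y • dx + x • dy

theorem v₁_v₂ (f : SmoothPlane) : v₁ (v₂ f) = v₂ (v₁ f) := by
  simp [v₁, v₂, dx_x, dx_y, dy_x, dy_y, dx_dy]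
  ring

/-- The submodule `E` of the vector fields on `ℝ²` generated by `v₁` and `v₂`, which is
involutive. -/
def elliptic : LieRinehartSubalgebra SmoothPlane (Derivation ℝ SmoothPlane SmoothPlane) where
  toSubmodule := Submodule.span SmoothPlane {v₁, v₂}
  lie_mem' := by
    intro a b ha hb
    change a ∈ Submodule.span SmoothPlane {v₁, v₂} at ha
    change b ∈ Submodule.span SmoothPlane {v₁, v₂} at hb
    change ⁅a, b⁆ ∈ Submodule.span SmoothPlane {v₁, v₂}
    rw [Submodule.mem_span_pair] at ha hb ⊢
    obtain ⟨a₁, a₂, rfl⟩ := ha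
    obtain ⟨b₁, b₂, rfl⟩ := hb
    refine ⟨(a₁ • v₁ + a₂ • v₂) b₁ - (b₁ • v₁ + b₂ • v₂) a₁,
      (a₁ • v₁ + a₂ • v₂) b₂ - (b₁ • v₁ + b₂ • v₂) a₂, ?_⟩
    refine Derivation.ext fun f => ?_
    simp only [Derivation.commutator_apply, Derivation.add_apply, Derivation.smul_apply,
      smul_eq_mul, Derivation.leibniz, map_add, v₁_v₂]
    ring

/-- `E` is free with basis `v₁`, `v₂`. -/
theorem v₁_v₂_independent (a b : SmoothPlane) (h : a • v₁ + b • v₂ = 0) : a = 0 ∧ b = 0 := by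
  have hx : a * x - b * y = 0 := by
    have := DFunLike.congr_fun h x
    simpa [v₁, v₂, dx_x, dy_x, sub_eq_add_neg] using this
  have hy : a * y + b * x = 0 := by
    have := DFunLike.congr_fun h y
    simpa [v₁, v₂, dx_y, dy_y] using this
  have key : ∀ c : SmoothPlane, c * (x ^ 2 + y ^ 2) = 0 → c = 0 := by
    intro c hc
    have hd : Dense ({0}ᶜ : Set (ℝ × ℝ)) := dense_compl_singleton 0
    have : (c : ℝ × ℝ → ℝ) = fun _ => 0 := by
      refine c.contDiff.continuous.ext_on hd continuous_const fun p hp => ?_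
      have h1 : c p * (p.1 ^ 2 + p.2 ^ 2) = 0 := DFunLike.congr_fun hc p
      rcases mul_eq_zero.1 h1 with h2 | h2
      · exact h2
      · exact absurd (Prod.ext (by simp; nlinarith [sq_nonneg p.1, sq_nonneg p.2])
          (by simp; nlinarith [sq_nonneg p.1, sq_nonneg p.2])) hp
    ext p
    exact congrFun this p
  exact ⟨key a (by linear_combination x * hx + y * hy),
    key b (by linear_combination x * hy - y * hx)⟩

/-- The Poisson structure `Π_E = v₁ ∧ v₂` on `ℝ²`. -/
def ellipticPoisson : PoissonStructure SmoothPlane := PoissonStructure.wedge v₁ v₂ v₁_v₂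

/-- `Π_E = (x² + y²) ∂/∂x ∧ ∂/∂y`. -/
theorem ellipticPoisson_bracket (f g : SmoothPlane) :
    ellipticPoisson.bracket f g = (x ^ 2 + y ^ 2) * (dx f * dy g - dy f * dx g) := by
  change v₁ f * v₂ g - v₂ f * v₁ g = _
  simp [v₁, v₂]
  ring

end SmoothPlane

end

/-!
Write `A` for the smooth functions on `ℝ²`. In the commuting frame `v₁`, `v₂` of `E` the
differential from degree one to degree two becomes `(f, g) ↦ v₁ f + v₂ g`, and every form of degree
two is closed, so that `ᴱH²` is `A / (v₁ A + v₂ A)`. Both `v₁` and `v₂` vanish at the origin, and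
integrating along rays shows that the Euler field `v₁` maps `A` onto the functions vanishing there:
only the value at the origin survives.

On bivector fields `a ∂/∂x ∧ ∂/∂y` the Poisson differential of a vector field `X` has coefficient
`ρ div X - X ρ` with `ρ = x² + y²`. If `a = x b + y c`, then the Laplacian of `a` at the origin is
twice the divergence of `(b, c)` there. It follows that `ρ div X - X ρ` vanishes at the origin
together with its Laplacian. Conversely, if `a` does, then `div (b, c) = v₁ h` for some `h`, and the
differential of `h v₁ - (b, c)`, which is `ρ v₁ h - ρ div (b, c) + 2 (x b + y c)`, equals `2 a`.
-/

noncomputable section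

open Module

section ParametricIntegral

open MeasureTheory Set Topology

universe u

variable {H F : Type u} [NormedAddCommGroup H] [NormedSpace ℝ H]
  [NormedAddCommGroup F] [NormedSpace ℝ F]
  {μ : Measure ℝ} [IsLocallyFiniteMeasure μ]

theorem hasFDerivAt_intervalIntegral_of_contDiff {f : H × ℝ → F} (hf : ContDiff ℝ 1 f)
    (a b : ℝ) (x₀ : H) :
    HasFDerivAt (fun x => ∫ t in a..b, f (x, t) ∂μ)
      (∫ t in a..b, (fderiv ℝ f (x₀, t)).comp (.inl ℝ H ℝ) ∂μ) x₀ := by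
  have hpartial : Continuous fun q : H × ℝ => (fderiv ℝ f q).comp (.inl ℝ H ℝ) :=
    (hf.continuous_fderiv one_ne_zero).clm_comp continuous_const
  have hline (x : H) : Continuous fun t : ℝ => (x, t) := by fun_prop
  obtain ⟨C, hC⟩ := isCompact_uIcc.exists_bound_of_continuousOn (s := uIcc a b)
    (hpartial.comp (hline x₀)).continuousOn
  have hbound : ∀ᶠ x in 𝓝 x₀, ∀ t ∈ uIcc a b,
      ‖(fderiv ℝ f (x, t)).comp (.inl ℝ H ℝ)‖ < C + 1 :=
    isCompact_uIcc.eventually_forall_of_forall_eventually fun t ht =>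
      hpartial.norm.continuousAt.eventually_lt_const ((hC t ht).trans_lt (lt_add_one C))
  refine intervalIntegral.hasFDerivAt_integral_of_dominated_of_fderiv_le
    (F' := fun x t => (fderiv ℝ f (x, t)).comp (.inl ℝ H ℝ)) hbound
    (.of_forall fun x => (hf.continuous.comp (hline x)).aestronglyMeasurable)
    ((hf.continuous.comp (hline x₀)).intervalIntegrable _ _)
    (hpartial.comp (hline x₀)).aestronglyMeasurable
    (.of_forall fun t ht x hx => (hx t (uIoc_subset_uIcc ht)).le)
    intervalIntegrable_const (.of_forall fun t _ x _ => ?_)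
  exact (hf.differentiable one_ne_zero (x, t)).hasFDerivAt.comp x (hasFDerivAt_prodMk_left x t)

variable [NullSingletonClass μ]

theorem contDiff_nat_intervalIntegral {n : ℕ} {f : H × ℝ → F} (hf : ContDiff ℝ n f) (a b : ℝ) :
    ContDiff ℝ n (fun x => ∫ t in a..b, f (x, t) ∂μ) := by
  induction n generalizing F with
  | zero =>
    exact contDiff_zero.2 (intervalIntegral.continuous_parametric_intervalIntegral_of_continuous'
      (f := fun x t => f (x, t)) hf.continuous a b)
  | succ n ih =>
    have hderiv := hasFDerivAt_intervalIntegral_of_contDiff (μ := μ)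
      (hf.of_le (mod_cast Nat.le_add_left 1 n)) a b
    push_cast
    refine contDiff_succ_iff_fderiv.2 ⟨fun x => (hderiv x).differentiableAt, by simp, ?_⟩
    rw [funext fun x => (hderiv x).fderiv]
    exact ih ((hf.fderiv_right le_rfl).clm_comp contDiff_const)

theorem contDiff_intervalIntegral {n : ℕ∞} {f : H × ℝ → F} (hf : ContDiff ℝ n f) (a b : ℝ) :
    ContDiff ℝ n (fun x => ∫ t in a..b, f (x, t) ∂μ) :=
  contDiff_iff_forall_nat_le.2 fun _ hm =>
    contDiff_nat_intervalIntegral (hf.of_le (mod_cast hm)) a b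

end ParametricIntegral

section SegmentMean

open scoped ContDiff

universe u

variable {H F : Type u} [NormedAddCommGroup H] [NormedSpace ℝ H]
  [NormedAddCommGroup F] [NormedSpace ℝ F]

/-- The mean `∫₀¹ f(c + t(p - c)) dt` of `f` over the segment from `c` to `p`: the coefficients in
Hadamard's lemma are the segment means of the partial derivatives. -/
def segmentMean (f : H → F) (c p : H) : F := ∫ t in (0 : ℝ)..1, f (c + t • (p - c))

theorem contDiff_segmentMean {n : ℕ∞} {f : H → F} (hf : ContDiff ℝ n f) (c : H) :
    ContDiff ℝ n (segmentMean f c) :=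
  contDiff_intervalIntegral (f := fun q : H × ℝ => f (c + q.2 • (q.1 - c)))
    (hf.comp (by fun_prop)) 0 1

theorem segmentMean_clm_apply {B : H → H →L[ℝ] F} (hB : Continuous B) (c p v : H) :
    segmentMean B c p v = ∫ t in (0 : ℝ)..1, B (c + t • (p - c)) v :=
  ContinuousLinearMap.intervalIntegral_apply
    ((hB.comp (by fun_prop)).intervalIntegrable 0 1) v

variable [CompleteSpace F]

theorem segmentMean_self (f : H → F) (c : H) : segmentMean f c c = f c := by
  simp [segmentMean]

theorem eq_add_segmentMean_fderiv {f : H → F} (hf : ContDiff ℝ 1 f) (c p : H) :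
    f p = f c + segmentMean (fderiv ℝ f) c p (p - c) := by
  have hderiv := hf.continuous_fderiv one_ne_zero
  have hftc : ∫ t in (0 : ℝ)..1, fderiv ℝ f (c + t • (p - c)) (p - c) = f p - f c := by
    have h (t : ℝ) : HasDerivAt (fun t : ℝ => f (c + t • (p - c)))
        (fderiv ℝ f (c + t • (p - c)) (p - c)) t := by
      have hline : HasDerivAt (fun t : ℝ => c + t • (p - c)) (p - c) t := by
        simpa using ((hasDerivAt_id t).smul_const (p - c)).const_add c
      exact (hf.differentiable one_ne_zero _).hasFDerivAt.comp_hasDerivAt t hline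
    simpa using intervalIntegral.integral_eq_sub_of_hasDerivAt (a := 0) (b := 1)
      (fun t _ => h t) (((hderiv.comp (by fun_prop)).clm_apply
        continuous_const).intervalIntegrable 0 1)
  rw [segmentMean_clm_apply hderiv, hftc, add_sub_cancel]

theorem fderiv_segmentMean_apply_self {B : H → H →L[ℝ] F} (hB : ContDiff ℝ 1 B) (p : H) :
    fderiv ℝ (fun p => segmentMean B 0 p p) p p = B p p := by
  have hray (s : ℝ) :
      segmentMean B 0 (s • p) (s • p) = ∫ t in (0 : ℝ)..s, B (t • p) p := by
    have := intervalIntegral.smul_integral_comp_mul_left (a := 0) (b := 1)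
      (fun t : ℝ => B (t • p) p) s
    rw [mul_zero, mul_one] at this
    rw [segmentMean_clm_apply hB.continuous, ← this]
    simp [smul_smul, mul_comm s]
  have hcont : Continuous fun t : ℝ => B (t • p) p :=
    (hB.continuous.comp (by fun_prop)).clm_apply continuous_const
  have hftc : HasDerivAt (fun s : ℝ => segmentMean B 0 (s • p) (s • p)) (B p p) 1 := by
    simpa only [hray, one_smul] using hcont.integral_hasStrictDerivAt 0 1 |>.hasDerivAt
  have hchain : HasDerivAt (fun s : ℝ => segmentMean B 0 (s • p) (s • p))
      (fderiv ℝ (fun p => segmentMean B 0 p p) p p) 1 := by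
    have hdiff : DifferentiableAt ℝ (fun p => segmentMean B 0 p p) ((1 : ℝ) • p) :=
      (((contDiff_segmentMean (n := 1) hB 0).clm_apply contDiff_id).differentiable one_ne_zero) _
    have hline : HasDerivAt (fun s : ℝ => s • p) p 1 := by
      simpa using (hasDerivAt_id (1 : ℝ)).smul_const p
    simpa only [one_smul, Function.comp_def] using hdiff.hasFDerivAt.comp_hasDerivAt 1 hline
  exact hchain.unique hftc

/-- The solution is `g p = ∫₀¹ a(tp) / t dt`, and Hadamard's lemma divides `a(tp)` by `t`. -/
theorem exists_contDiff_fderiv_apply_self_eq {a : H → F} (ha : ContDiff ℝ ∞ a) (ha₀ : a 0 = 0) :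
    ∃ g : H → F, ContDiff ℝ ∞ g ∧ ∀ p, fderiv ℝ g p p = a p := by
  have hB : ContDiff ℝ ∞ (segmentMean (fderiv ℝ a) 0) :=
    contDiff_segmentMean (ha.fderiv_right (m := ∞) (by simp)) 0
  refine ⟨fun p => segmentMean (segmentMean (fderiv ℝ a) 0) 0 p p,
    (contDiff_segmentMean hB 0).clm_apply contDiff_id, fun p => ?_⟩
  rw [fderiv_segmentMean_apply_self (hB.of_le (mod_cast le_top))]
  simpa [ha₀] using (eq_add_segmentMean_fderiv (ha.of_le (mod_cast le_top)) 0 p).symm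

end SegmentMean

section Koszul

variable {L M : Type*} [AddCommGroup M] (br : L → L → L) (act : L → M → M)

theorem koszul_fin_one (ω : (Fin 1 → L) → M) (V : Fin 2 → L) :
    koszul br act ω V =
      act (V 0) (ω ![V 1]) - act (V 1) (ω ![V 0]) - ω ![br (V 0) (V 1)] := by
  have h0 : (0 : Fin 2).removeNth V = ![V 1] := List.ofFn_inj.1 rfl
  have h1 : (1 : Fin 2).removeNth V = ![V 0] := List.ofFn_inj.1 rfl
  have hcons (v : L) (W : Fin 0 → L) : (Fin.cons v W : Fin 1 → L) = ![v] := List.ofFn_inj.1 rfl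
  change (∑ i : Fin 2, _) + (∑ j : Fin 2, ∑ i : Fin 1, _) = _
  simp only [Int.reduceNeg, Nat.reduceAdd, Fin.sum_univ_two, Fin.isValue, Fin.coe_ofNat_eq_mod,
    Nat.zero_mod, pow_zero, h0, one_smul, Nat.mod_succ, pow_one, h1, neg_smul, Finset.univ_unique,
    Fin.default_eq_zero, Fin.val_eq_zero, zero_add, hcons, Finset.sum_singleton, Fin.castSucc_zero,
    lt_self_iff_false, ↓reduceIte, zero_lt_one]
  abel

theorem koszul_fin_two (ω : (Fin 2 → L) → M) (V : Fin 3 → L) :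
    koszul br act ω V =
      act (V 0) (ω ![V 1, V 2]) - act (V 1) (ω ![V 0, V 2]) + act (V 2) (ω ![V 0, V 1])
        - ω ![br (V 0) (V 1), V 2] + ω ![br (V 0) (V 2), V 1] - ω ![br (V 1) (V 2), V 0] := by
  have h0 : (0 : Fin 3).removeNth V = ![V 1, V 2] := List.ofFn_inj.1 rfl
  have h1 : (1 : Fin 3).removeNth V = ![V 0, V 2] := List.ofFn_inj.1 rfl
  have h2 : (2 : Fin 3).removeNth V = ![V 0, V 1] := List.ofFn_inj.1 rfl
  have k0 (W : Fin 2 → L) : (0 : Fin 2).removeNth W = ![W 1] := List.ofFn_inj.1 rfl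
  have k1 (W : Fin 2 → L) : (1 : Fin 2).removeNth W = ![W 0] := List.ofFn_inj.1 rfl
  have hcons (v w : L) : (Fin.cons v ![w] : Fin 2 → L) = ![v, w] := rfl
  have c1 : (1 : Fin 2).castSucc = (1 : Fin 3) := rfl
  change (∑ i : Fin 3, _) + (∑ j : Fin 3, ∑ i : Fin 2, _) = _
  simp only [Int.reduceNeg, Nat.reduceAdd, Fin.sum_univ_three, Fin.isValue, Fin.coe_ofNat_eq_mod,
    Nat.zero_mod, pow_zero, h0, Nat.succ_eq_add_one, one_smul, Nat.one_mod, pow_one, h1, neg_smul,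
    Nat.mod_succ, even_two, Even.neg_pow, one_pow, h2, Fin.sum_univ_two, Fin.castSucc_zero,
    zero_add, k0, hcons, c1, k1, lt_self_iff_false, ↓reduceIte, not_lt_zero, add_zero, zero_lt_one,
    Matrix.cons_val_one, Matrix.cons_val_fin_one, Fin.reduceLT, Int.reducePow, Matrix.cons_val_zero]
  abel

end Koszul

section Cohomology

variable {R : Type*} [CommRing R] {C : ℕ → Type*} [∀ p, AddCommGroup (C p)] [∀ p, Module R (C p)]
  {N : Type*} [AddCommGroup N] [Module R N]

/-- The cohomology in a degree where every cochain is closed, computed by coordinates `e` on the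
cochains which take the coboundaries to `B`. -/
def cohomologyEquivOfClosed {d : ∀ p, C p →ₗ[R] C (p + 1)} {Ω : ∀ p, Submodule R (C p)} {p : ℕ}
    (hclosed : Ω p ≤ LinearMap.ker (d p)) (e : Ω p ≃ₗ[R] N) (B : Submodule R N)
    (hB : ∀ ω : Ω p, (ω : C p) ∈ coboundaries d Ω p ↔ e ω ∈ B) :
    cohomology d Ω p ≃ₗ[R] N ⧸ B :=
  let e' : cocycles d Ω p ≃ₗ[R] N := (LinearEquiv.ofEq _ _ (inf_eq_left.2 hclosed)).trans e
  Submodule.Quotient.equiv _ _ e' <| by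
    refine le_antisymm (Submodule.map_le_iff_le_comap.2 fun ω hω => ?_) fun n hn => ?_
    · exact (hB ⟨ω, ω.2.1⟩).1 hω
    · refine ⟨e'.symm n, (hB ⟨e'.symm n, (e'.symm n).2.1⟩).2 ?_, e'.apply_symm_apply n⟩
      exact (e'.apply_symm_apply n).symm ▸ hn

end Cohomology

section LieRinehartBasis

variable {A : Type*} [CommRing A] [Algebra ℝ A]
  {E : LieRinehartSubalgebra A (Derivation ℝ A A)} {ι : Type*} (b : Basis ι A E)

theorem coe_apply_eq_sum_repr [Fintype ι] (V : E) (f : A) :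
    (V : Derivation ℝ A A) f = ∑ j, b.repr V j * (b j : Derivation ℝ A A) f := by
  let evalAt : E →ₗ[A] A :=
    { toFun := fun X => (X : Derivation ℝ A A) f
      map_add' := fun _ _ => rfl
      map_smul' := fun _ _ => rfl }
  change evalAt V = ∑ j, b.repr V j • evalAt (b j)
  conv_lhs => rw [← b.sum_repr V, map_sum]
  simp only [map_smul]

theorem repr_lie_eq_apply_repr_add_sum [Fintype ι] (V W : E) (i : ι) :
    b.repr ⁅V, W⁆ i =
      (V : Derivation ℝ A A) (b.repr W i) + ∑ j, b.repr W j * b.repr ⁅V, b j⁆ i := by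
  have hlie : ⁅V, W⁆ = ∑ j, (b.repr W j • ⁅V, b j⁆ + ⁅V, b.repr W j⁆ • b j) := by
    conv_lhs => rw [← b.sum_repr W, lie_sum]
    simp only [LieRinehartRing.leibniz_smul_right]
  rw [hlie, Finset.sum_add_distrib, map_add, Finsupp.add_apply, b.repr_sum_self, add_comm]
  congr 1
  simp [map_sum, Finsupp.finsetSum_apply]

theorem repr_lie_of_commute [Finite ι] (hb : ∀ i j, ⁅b i, b j⁆ = 0) (V W : E) (i : ι) :
    b.repr ⁅V, W⁆ i =
      (V : Derivation ℝ A A) (b.repr W i) - (W : Derivation ℝ A A) (b.repr V i) := by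
  cases nonempty_fintype ι
  have hbasis (j : ι) : b.repr ⁅V, b j⁆ i = -(b j : Derivation ℝ A A) (b.repr V i) := by
    rw [← lie_skew, map_neg, Finsupp.neg_apply, repr_lie_eq_apply_repr_add_sum]
    simp [hb]
  simp [repr_lie_eq_apply_repr_add_sum b V W, hbasis, coe_apply_eq_sum_repr b W, sub_eq_add_neg]

end LieRinehartBasis

namespace EForm

variable {A : Type*} [CommRing A] [Algebra ℝ A] {E : LieRinehartSubalgebra A (Derivation ℝ A A)}

theorem mem_one_iff {ω : (Fin 1 → E) → A} :
    ω ∈ EForm E 1 ↔ ∃ l : E →ₗ[A] A, ω = fun V => l (V 0) := by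
  constructor
  · rintro ⟨α, rfl⟩
    obtain ⟨l, rfl⟩ := (AlternatingMap.ofSubsingleton A E A (0 : Fin 1)).surjective α
    exact ⟨l, rfl⟩
  · rintro ⟨l, rfl⟩
    exact ⟨AlternatingMap.ofSubsingleton A E A 0 l, rfl⟩

/-- The coefficient of a form of top degree with respect to the determinant of a basis. -/
def topEquiv {n : ℕ} (b : Basis (Fin n) A E) : EForm E n ≃ₗ[ℝ] A where
  toFun ω := (ω : (Fin n → E) → A) b
  invFun a := ⟨⇑(a • b.det), _, rfl⟩
  map_add' _ _ := rfl
  map_smul' _ _ := rfl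
  left_inv := by
    rintro ⟨_, α, rfl⟩
    exact Subtype.ext (congrArg DFunLike.coe (α.eq_smul_basis_det b).symm)
  right_inv a := by simp [b.det_self]

variable (b : Basis (Fin 2) A E)

theorem det_apply (V : Fin 2 → E) :
    b.det V = b.repr (V 0) 0 * b.repr (V 1) 1 - b.repr (V 1) 0 * b.repr (V 0) 1 := by
  simp [Basis.det_apply, Matrix.det_fin_two, Basis.toMatrix_apply]

variable {b} (hb : ∀ i j, ⁅b i, b j⁆ = 0)
include hb

theorem d_one_apply (l : E →ₗ[A] A) :
    EForm.d E 1 (fun V => l (V 0)) =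
      ⇑(((b 0 : Derivation ℝ A A) (l (b 1)) - (b 1 : Derivation ℝ A A) (l (b 0))) • b.det) := by
  have hl (V : E) : l V = b.repr V 0 * l (b 0) + b.repr V 1 * l (b 1) := by
    conv_lhs => rw [← b.sum_repr V, Fin.sum_univ_two]
    simp only [map_add, map_smul, smul_eq_mul]
  funext V
  rw [AlternatingMap.smul_apply, smul_eq_mul, det_apply]
  change koszul _ _ _ _ = _
  rw [koszul_fin_one]
  simp only [Matrix.cons_val_zero, Derivation.coeFn_coe]
  rw [hl ⁅_, _⁆, hl (V 0), hl (V 1)]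
  simp only [repr_lie_of_commute b hb, coe_apply_eq_sum_repr b (V 0), coe_apply_eq_sum_repr b (V 1),
    Fin.sum_univ_two, map_add, Derivation.leibniz, smul_eq_mul]
  ring

theorem two_le_ker_d : EForm E 2 ≤ LinearMap.ker (EForm.d E 2) := by
  rintro _ ⟨α, rfl⟩
  have hα (V W : E) : α ![V, W] =
      α b * (b.repr V 0 * b.repr W 1 - b.repr W 0 * b.repr V 1) := by
    conv_lhs => rw [α.eq_smul_basis_det b, AlternatingMap.smul_apply, smul_eq_mul, det_apply]
    rfl
  refine LinearMap.mem_ker.2 (funext fun V => ?_)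
  change koszul _ _ _ _ = 0
  rw [koszul_fin_two]
  simp only [hα, repr_lie_of_commute b hb, coe_apply_eq_sum_repr b (V _), Derivation.coeFn_coe,
    Fin.sum_univ_two, map_sub, Derivation.leibniz, smul_eq_mul]
  ring

theorem mem_coboundaries_two_iff (ω : EForm E 2) :
    (ω : (Fin 2 → E) → A) ∈ coboundaries (EForm.d E) (EForm E) 2 ↔
      topEquiv b ω ∈ LinearMap.range ((b 0 : Derivation ℝ A A) : A →ₗ[ℝ] A) ⊔
        LinearMap.range ((b 1 : Derivation ℝ A A) : A →ₗ[ℝ] A) := by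
  obtain ⟨a, rfl⟩ := (topEquiv b).symm.surjective ω
  rw [LinearEquiv.apply_symm_apply, Submodule.mem_sup]
  constructor
  · rintro ⟨-, η, hη, hd⟩
    obtain ⟨l, rfl⟩ := mem_one_iff.1 hη
    rw [d_one_apply hb] at hd
    have ha := congrFun hd b
    refine ⟨_, ⟨l (b 1), rfl⟩, _, ⟨-l (b 0), rfl⟩, ?_⟩
    simpa [topEquiv, b.det_self, sub_eq_add_neg] using ha
  · rintro ⟨_, ⟨f, rfl⟩, _, ⟨g, rfl⟩, rfl⟩
    refine ⟨((topEquiv b).symm _).2, _, mem_one_iff.2 ⟨b.constr A ![-g, f], rfl⟩, ?_⟩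
    rw [d_one_apply hb]
    simp [topEquiv]

/-- In rank two, the second cohomology is the space of functions modulo the images of the two
commuting frame fields. -/
def cohomologyTwoEquiv : ECohomology E 2 ≃ₗ[ℝ]
    A ⧸ (LinearMap.range ((b 0 : Derivation ℝ A A) : A →ₗ[ℝ] A) ⊔
      LinearMap.range ((b 1 : Derivation ℝ A A) : A →ₗ[ℝ] A)) :=
  cohomologyEquivOfClosed (two_le_ker_d hb) (topEquiv b) _ (mem_coboundaries_two_iff hb)

end EForm

namespace Multivector

variable {A : Type*} [CommRing A] [Algebra ℝ A]

/-- The vector field obtained from a multivector field by fixing all arguments but the first. -/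
def contract {n : ℕ} (P : Multivector A (n + 1)) (F : Fin n → A) : Derivation ℝ A A :=
  Derivation.mk'
    { toFun := fun f => (P : (Fin (n + 1) → A) → A) (Matrix.vecCons f F)
      map_add' := fun f g => by
        obtain ⟨Q, hQ⟩ := P.2.1
        simp only [← hQ, Q.map_vecCons_add]
      map_smul' := fun r f => by
        obtain ⟨Q, hQ⟩ := P.2.1
        simp only [← hQ, Q.map_vecCons_smul, RingHom.id_apply] }
    fun f g => by
      have hleibniz := P.2.2 (Matrix.vecCons 0 F) 0 f g
      simp only [Matrix.vecCons, Fin.update_cons_zero] at hleibniz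
      exact hleibniz

theorem contract_apply {n : ℕ} (P : Multivector A (n + 1)) (F : Fin n → A) (f : A) :
    contract P F f = (P : (Fin (n + 1) → A) → A) (Matrix.vecCons f F) := rfl

theorem mem_one_iff {P : (Fin 1 → A) → A} :
    P ∈ Multivector A 1 ↔ ∃ X : Derivation ℝ A A, P = fun F => X (F 0) := by
  constructor
  · intro hP
    refine ⟨contract ⟨P, hP⟩ ![], funext fun F => congrArg P ?_⟩
    exact List.ofFn_inj.1 rfl
  · rintro ⟨X, rfl⟩
    refine ⟨⟨AlternatingMap.ofSubsingleton ℝ A A 0 (X : A →ₗ[ℝ] A), rfl⟩, fun F i g h => ?_⟩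
    obtain rfl : i = 0 := Subsingleton.elim _ _
    simp

theorem apply_self (P : Multivector A 2) (f : A) : (P : (Fin 2 → A) → A) ![f, f] = 0 := by
  obtain ⟨Q, hQ⟩ := P.2.1
  rw [← hQ]
  exact Q.map_eq_zero_of_eq _ (i := 0) (j := 1) rfl zero_ne_one

theorem apply_swap (P : Multivector A 2) (f g : A) :
    (P : (Fin 2 → A) → A) ![f, g] = -(P : (Fin 2 → A) → A) ![g, f] := by
  obtain ⟨Q, hQ⟩ := P.2.1
  rw [← hQ, ← Q.map_swap ![g, f] (zero_ne_one : (0 : Fin 2) ≠ 1)]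
  exact congrArg Q (List.ofFn_inj.1 rfl)

/-- The bivector field `v ∧ w`. -/
def wedge (v w : Derivation ℝ A A) : Multivector A 2 where
  val F := v (F 0) * w (F 1) - w (F 0) * v (F 1)
  property := by
    refine ⟨⟨.mk (.mk (fun F => v (F 0) * w (F 1) - w (F 0) * v (F 1)) ?_ ?_) ?_, rfl⟩, ?_⟩
    · intro inst F i f g
      rw [Subsingleton.elim inst (instDecidableEqFin 2)]
      fin_cases i <;> simp <;> ring
    · intro inst F i r f
      rw [Subsingleton.elim inst (instDecidableEqFin 2)]
      fin_cases i <;> simp [← smul_sub]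
    · intro F i j h hij
      fin_cases i <;> fin_cases j <;> simp_all [mul_comm]
    · intro F i f g
      fin_cases i <;> simp <;> ring

end Multivector

namespace PoissonStructure

variable {A : Type*} [CommRing A] [Algebra ℝ A]

/-- The Hamiltonian vector field `{f, ·}`. -/
def hamiltonian (π : PoissonStructure A) (f : A) : Derivation ℝ A A :=
  Derivation.mk' (π.bracket f) (π.leibniz f)

theorem bracket_swap (π : PoissonStructure A) (f g : A) : π.bracket f g = -π.bracket g f :=
  (LinearMap.IsAlt.neg (B := π.bracket) π.bracket_self g f).symm

end PoissonStructure

/-- Global coordinates `x`, `y` on a two-dimensional algebra of functions, with the coordinate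
vector fields `∂/∂x` and `∂/∂y`. -/
structure PlaneCoordinates (A : Type*) [CommRing A] [Algebra ℝ A] where
  x : A
  y : A
  dx : Derivation ℝ A A
  dy : Derivation ℝ A A
  dx_x : dx x = 1
  dx_y : dx y = 0
  dy_x : dy x = 0
  dy_y : dy y = 1
  apply_eq : ∀ (D : Derivation ℝ A A) (f : A), D f = dx f * D x + dy f * D y

namespace PlaneCoordinates

variable {A : Type*} [CommRing A] [Algebra ℝ A] (c : PlaneCoordinates A)

theorem dx_dy (f : A) : c.dx (c.dy f) = c.dy (c.dx f) := by
  rw [← sub_eq_zero, ← Derivation.commutator_apply, c.apply_eq]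
  simp [Derivation.commutator_apply, c.dx_x, c.dx_y, c.dy_x, c.dy_y]

theorem apply_eq_mul_jacobian (D : A → Derivation ℝ A A) (hself : ∀ f, D f f = 0)
    (hswap : ∀ f g, D f g = -D g f) (f g : A) :
    D f g = D c.x c.y * (c.dx f * c.dy g - c.dy f * c.dx g) := by
  rw [c.apply_eq (D f) g, hswap f c.x, hswap f c.y, c.apply_eq (D c.x) f, c.apply_eq (D c.y) f,
    hself, hself, hswap c.y c.x]
  ring

theorem bivector_apply (P : Multivector A 2) (f g : A) :
    (P : (Fin 2 → A) → A) ![f, g] =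
      (P : (Fin 2 → A) → A) ![c.x, c.y] * (c.dx f * c.dy g - c.dy f * c.dx g) := by
  have h := c.apply_eq_mul_jacobian (fun f => Multivector.contract P ![f])
    (fun f => Multivector.apply_self P f) (fun f g => Multivector.apply_swap P g f) g f
  simp only [Multivector.contract_apply] at h
  rw [h, Multivector.apply_swap P c.y c.x]
  ring

theorem bracket_apply (π : PoissonStructure A) (f g : A) :
    π.bracket f g = π.bracket c.x c.y * (c.dx f * c.dy g - c.dy f * c.dx g) :=
  c.apply_eq_mul_jacobian π.hamiltonian π.bracket_self π.bracket_swap f g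

/-- The coefficient of a bivector field with respect to `∂/∂x ∧ ∂/∂y`. -/
def bivectorEquiv : Multivector A 2 ≃ₗ[ℝ] A where
  toFun P := (P : (Fin 2 → A) → A) ![c.x, c.y]
  invFun a := Multivector.wedge (a • c.dx) c.dy
  map_add' _ _ := rfl
  map_smul' _ _ := rfl
  left_inv P := by
    refine Subtype.ext (funext fun F => ?_)
    have hF : F = ![F 0, F 1] := List.ofFn_inj.1 rfl
    conv_rhs => rw [hF, c.bivector_apply]
    simp only [Multivector.wedge, Derivation.smul_apply, smul_eq_mul]
    ring
  right_inv a := by simp [Multivector.wedge, c.dx_x, c.dx_y, c.dy_x, c.dy_y]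

/-- The Poisson differential on vector fields, `X ↦ ρ div X - X ρ`, where the Poisson bivector is
`ρ ∂/∂x ∧ ∂/∂y` and bivector fields are identified with their coefficients. -/
def vectorFieldDifferential (π : PoissonStructure A) : Derivation ℝ A A →ₗ[ℝ] A where
  toFun X := π.bracket c.x c.y * (c.dx (X c.x) + c.dy (X c.y)) - X (π.bracket c.x c.y)
  map_add' X Y := by
    simp only [Derivation.add_apply, map_add]
    ring
  map_smul' r X := by
    simp only [Derivation.smul_apply, Derivation.map_smul, RingHom.id_apply, ← smul_add, smul_sub,
      mul_smul_comm]

variable (π : PoissonStructure A)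

theorem d_vectorField (X : Derivation ℝ A A) :
    Multivector.d π 1 (fun F => X (F 0)) =
      (c.bivectorEquiv.symm (c.vectorFieldDifferential π X) : (Fin 2 → A) → A) := by
  funext F
  change koszul _ _ _ _ = c.vectorFieldDifferential π X * c.dx (F 0) * c.dy (F 1) -
    c.dy (F 0) * (c.vectorFieldDifferential π X * c.dx (F 1))
  rw [koszul_fin_one]
  simp only [Matrix.cons_val_zero, vectorFieldDifferential, LinearMap.coe_mk, AddHom.coe_mk]
  rw [c.bracket_apply π, c.bracket_apply π (F 1), c.bracket_apply π (F 0) (F 1),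
    c.apply_eq X (F 0), c.apply_eq X (F 1), Derivation.leibniz, c.apply_eq X (_ - _)]
  simp only [map_add, map_sub, Derivation.leibniz, smul_eq_mul, c.dx_dy]
  ring

include c in
theorem bivector_le_ker_d : Multivector A 2 ≤ LinearMap.ker (Multivector.d π 2) := by
  intro P hP
  have hbivector := c.bivector_apply ⟨P, hP⟩
  dsimp only at hbivector
  refine LinearMap.mem_ker.2 (funext fun F => ?_)
  change koszul _ _ _ _ = 0
  rw [koszul_fin_two]
  generalize P ![c.x, c.y] = φ at hbivector
  have hbracket := c.bracket_apply π
  generalize π.bracket c.x c.y = ρ at hbracket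
  simp only [hbivector, hbracket, map_sub, Derivation.leibniz, smul_eq_mul, c.dx_dy]
  ring

theorem mem_coboundaries_two_iff (P : Multivector A 2) :
    (P : (Fin 2 → A) → A) ∈ coboundaries (Multivector.d π) (Multivector A) 2 ↔
      c.bivectorEquiv P ∈ LinearMap.range (c.vectorFieldDifferential π) := by
  constructor
  · rintro ⟨-, Q, hQ, hd⟩
    obtain ⟨X, rfl⟩ := Multivector.mem_one_iff.1 hQ
    rw [d_vectorField, SetLike.coe_eq_coe] at hd
    exact ⟨X, c.bivectorEquiv.symm_apply_eq.1 hd⟩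
  · rintro ⟨X, hX⟩
    refine ⟨P.2, _, Multivector.mem_one_iff.2 ⟨X, rfl⟩, ?_⟩
    rw [c.d_vectorField, hX, LinearEquiv.symm_apply_apply]

/-- In dimension two, the second Poisson cohomology is the space of functions modulo the
`ρ div X - X ρ`. -/
def poissonCohomologyTwoEquiv :
    PoissonCohomology π 2 ≃ₗ[ℝ] A ⧸ LinearMap.range (c.vectorFieldDifferential π) :=
  cohomologyEquivOfClosed (c.bivector_le_ker_d π) c.bivectorEquiv _ (c.mem_coboundaries_two_iff π)

end PlaneCoordinates

namespace SmoothPlane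

open scoped ContDiff

/-- Evaluation of smooth functions at a point. -/
def eval (p : ℝ × ℝ) : SmoothPlane →ₐ[ℝ] ℝ := (Pi.evalAlgHom ℝ _ p).comp ContMDiffMap.coeFnAlgHom

theorem eval_apply (p : ℝ × ℝ) (f : SmoothPlane) : eval p f = f p := rfl

@[simp] theorem eval_x (p : ℝ × ℝ) : eval p x = p.1 := rfl

@[simp] theorem eval_y (p : ℝ × ℝ) : eval p y = p.2 := rfl

section Coordinates

theorem clm_apply_eq (B : ℝ × ℝ →L[ℝ] ℝ) (u : ℝ × ℝ) :
    B u = u.1 * B (1, 0) + u.2 * B (0, 1) := by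
  have hu : u = u.1 • (1, 0) + u.2 • (0, 1) := by simp
  conv_lhs => rw [hu, map_add, map_smul, map_smul, smul_eq_mul, smul_eq_mul]

theorem exists_eq_add_mul_add_mul (f : SmoothPlane) (c : ℝ × ℝ) :
    ∃ g h : SmoothPlane, eval c g = eval c (dx f) ∧ eval c h = eval c (dy f) ∧
      f = algebraMap ℝ _ (eval c f) + (x - algebraMap ℝ _ c.1) * g +
        (y - algebraMap ℝ _ c.2) * h := by
  have hsmooth : ContDiff ℝ ∞ (segmentMean (fderiv ℝ f) c) :=
    contDiff_segmentMean (f.contDiff.fderiv_right (m := ∞) (by simp)) c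
  let g (u : ℝ × ℝ) : SmoothPlane :=
    ⟨fun p => segmentMean (fderiv ℝ f) c p u, (hsmooth.clm_apply contDiff_const).contMDiff⟩
  have hg (u : ℝ × ℝ) : eval c (g u) = fderiv ℝ f c u :=
    congrArg (· u) (segmentMean_self (fderiv ℝ f) c)
  refine ⟨g (1, 0), g (0, 1), hg _, hg _, DFunLike.ext _ _ fun p => ?_⟩
  have hadamard := eq_add_segmentMean_fderiv (f.contDiff.of_le (mod_cast le_top)) c p
  rw [clm_apply_eq, ← add_assoc] at hadamard
  exact hadamard

theorem derivation_apply_eq (D : Derivation ℝ SmoothPlane SmoothPlane) (f : SmoothPlane) :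
    D f = dx f * D x + dy f * D y := by
  refine DFunLike.ext _ _ fun p => ?_
  obtain ⟨g, h, hg, hh, hf⟩ := exists_eq_add_mul_add_mul f p
  simp only [← eval_apply, map_add, map_mul, ← hg, ← hh]
  conv_lhs => rw [hf]
  simp [mul_comm]

/-- The standard coordinates of the plane. -/
def coordinates : PlaneCoordinates SmoothPlane where
  x := x
  y := y
  dx := dx
  dy := dy
  dx_x := dx_x
  dx_y := dx_y
  dy_x := dy_x
  dy_y := dy_y
  apply_eq := derivation_apply_eq

end Coordinates

section ECohomology

theorem exists_v₁_eq {a : SmoothPlane} (ha : eval 0 a = 0) : ∃ g, v₁ g = a := by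
  obtain ⟨g, hg, hga⟩ := exists_contDiff_fderiv_apply_self_eq a.contDiff ha
  refine ⟨⟨g, hg.contMDiff⟩, DFunLike.ext _ _ fun p => ?_⟩
  rw [← hga p, clm_apply_eq]
  rfl

theorem range_v₁_sup_range_v₂ :
    LinearMap.range (v₁ : SmoothPlane →ₗ[ℝ] SmoothPlane) ⊔
        LinearMap.range (v₂ : SmoothPlane →ₗ[ℝ] SmoothPlane) =
      LinearMap.ker (eval 0).toLinearMap := by
  refine le_antisymm (sup_le ?_ ?_) fun a ha => Submodule.mem_sup_left (exists_v₁_eq ha)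
  · rintro _ ⟨f, rfl⟩
    simp [v₁]
  · rintro _ ⟨f, rfl⟩
    simp [v₂]

/-- The basis `v₁`, `v₂` of `E`. -/
def ellipticBasis : Basis (Fin 2) SmoothPlane elliptic :=
  Basis.mk (v := ![⟨v₁, Submodule.subset_span (.inl rfl)⟩, ⟨v₂, Submodule.subset_span (.inr rfl)⟩])
    (LinearIndependent.pair_iff.2 fun a b h => v₁_v₂_independent a b (congrArg Subtype.val h))
    (by
      rintro ⟨V, hV⟩ -
      obtain ⟨a, b, rfl⟩ := Submodule.mem_span_pair.1 hV
      rw [Matrix.range_cons_cons_empty]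
      exact Submodule.mem_span_pair.2 ⟨a, b, rfl⟩)

theorem coe_ellipticBasis_zero : (ellipticBasis 0 : Derivation ℝ SmoothPlane SmoothPlane) = v₁ := by
  simp [ellipticBasis]

theorem coe_ellipticBasis_one : (ellipticBasis 1 : Derivation ℝ SmoothPlane SmoothPlane) = v₂ := by
  simp [ellipticBasis]

theorem lie_v₁_v₂ : ⁅v₁, v₂⁆ = 0 := by
  ext1 f
  rw [Derivation.commutator_apply, v₁_v₂, sub_self, Derivation.zero_apply]

theorem lie_ellipticBasis (i j : Fin 2) : ⁅ellipticBasis i, ellipticBasis j⁆ = 0 := by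
  have h : ⁅ellipticBasis 0, ellipticBasis 1⁆ = 0 := Subtype.ext <| by
    rw [LieRinehartSubalgebra.coe_bracket, coe_ellipticBasis_zero, coe_ellipticBasis_one]
    exact lie_v₁_v₂
  fin_cases i <;> fin_cases j
  · exact lie_self _
  · exact h
  · rw [← lie_skew]
    exact neg_eq_zero.2 h
  · exact lie_self _

/-- The isomorphism `ᴱH²(ℝ²) ≅ ℝ`. -/
def eCohomologyTwoEquiv : ECohomology elliptic 2 ≃ₗ[ℝ] ℝ :=
  (EForm.cohomologyTwoEquiv lie_ellipticBasis).trans <|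
    (Submodule.quotEquivOfEq _ _ <| by
      rw [coe_ellipticBasis_zero, coe_ellipticBasis_one, range_v₁_sup_range_v₂]).trans <|
    LinearMap.quotKerEquivOfSurjective _ fun r => ⟨algebraMap ℝ _ r, (eval 0).commutes r⟩

end ECohomology

section PoissonCohomology

/-- The Laplacian of the Euclidean metric. -/
def laplacian : SmoothPlane →ₗ[ℝ] SmoothPlane :=
  (dx : SmoothPlane →ₗ[ℝ] SmoothPlane) ∘ₗ dx + (dy : SmoothPlane →ₗ[ℝ] SmoothPlane) ∘ₗ dy

theorem laplacian_apply (f : SmoothPlane) : laplacian f = dx (dx f) + dy (dy f) := rfl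

theorem laplacian_mul (f g : SmoothPlane) :
    laplacian (f * g) =
      f * laplacian g + 2 * (dx f * dx g + dy f * dy g) + laplacian f * g := by
  simp only [laplacian_apply, Derivation.leibniz, map_add, smul_eq_mul]
  ring

theorem laplacian_x : laplacian x = 0 := by
  simp [laplacian_apply, dx_x, dy_x]

theorem laplacian_y : laplacian y = 0 := by
  simp [laplacian_apply, dx_y, dy_y]

theorem eval_zero_laplacian (b c : SmoothPlane) :
    eval 0 (laplacian (x * b + y * c)) = 2 * eval 0 (dx b + dy c) := by
  simp only [map_add, laplacian_mul, laplacian_x, laplacian_y, dx_x, dx_y, dy_x, dy_y, map_mul,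
    eval_x, eval_y, Prod.fst_zero, Prod.snd_zero, map_ofNat, map_one, map_zero]
  ring

/-- The value and the Laplacian of a function at the origin. -/
def valueLaplacianAtZero : SmoothPlane →ₗ[ℝ] (Fin 2 → ℝ) :=
  LinearMap.pi ![(eval 0).toLinearMap, (eval 0).toLinearMap ∘ₗ laplacian]

theorem mem_ker_valueLaplacianAtZero {a : SmoothPlane} :
    a ∈ LinearMap.ker valueLaplacianAtZero ↔ eval 0 a = 0 ∧ eval 0 (laplacian a) = 0 := by
  simp [valueLaplacianAtZero, funext_iff, Fin.forall_fin_two]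

theorem valueLaplacianAtZero_surjective : Function.Surjective valueLaplacianAtZero := fun r => by
  refine ⟨algebraMap ℝ _ (r 0) + (r 1 / 4) • (x * x + y * y), funext fun i => ?_⟩
  fin_cases i
  · simp [valueLaplacianAtZero]
  · have hconst : laplacian (algebraMap ℝ SmoothPlane (r 0)) = 0 := by simp [laplacian_apply]
    change eval 0 (laplacian _) = r 1
    rw [map_add, hconst, zero_add, map_smul, map_smul, eval_zero_laplacian, dx_x, dy_y, map_add,
      map_one, smul_eq_mul]
    ring

theorem vectorFieldDifferential_apply (X : Derivation ℝ SmoothPlane SmoothPlane) :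
    coordinates.vectorFieldDifferential ellipticPoisson X =
      (x ^ 2 + y ^ 2) * (dx (X x) + dy (X y)) - 2 * (x * X x + y * X y) := by
  change ellipticPoisson.bracket x y * (dx (X x) + dy (X y)) - X (ellipticPoisson.bracket x y) = _
  rw [ellipticPoisson_bracket, dx_x, dx_y, dy_x, dy_y, mul_one, mul_zero, sub_zero, mul_one]
  simp only [map_add, pow_two, Derivation.leibniz, smul_eq_mul]
  ring

theorem vectorFieldDifferential_smul_v₁ (h : SmoothPlane) :
    coordinates.vectorFieldDifferential ellipticPoisson (h • v₁) = (x ^ 2 + y ^ 2) * v₁ h := by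
  rw [vectorFieldDifferential_apply]
  simp only [v₁, smul_add, Derivation.coe_add, Derivation.coe_smul, Pi.add_apply, Pi.smul_apply,
    smul_eq_mul, Derivation.leibniz, map_add, map_zero, Derivation.map_one_eq_zero, dx_x, dx_y,
    dy_x, dy_y]
  ring

theorem vectorFieldDifferential_mem_ker (X : Derivation ℝ SmoothPlane SmoothPlane) :
    coordinates.vectorFieldDifferential ellipticPoisson X ∈
      LinearMap.ker valueLaplacianAtZero := by
  let δ := dx (X x) + dy (X y)
  have hX : coordinates.vectorFieldDifferential ellipticPoisson X =
      x * (x * δ - (X x + X x)) + y * (y * δ - (X y + X y)) := by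
    rw [vectorFieldDifferential_apply]
    ring
  rw [hX, mem_ker_valueLaplacianAtZero, eval_zero_laplacian]
  constructor
  · simp
  · simp [dx_x, dy_y, δ]

theorem exists_vectorFieldDifferential_eq {a : SmoothPlane} (ha : eval 0 a = 0)
    (hΔ : eval 0 (laplacian a) = 0) :
    ∃ X, coordinates.vectorFieldDifferential ellipticPoisson X = a := by
  obtain ⟨b, c, -, -, habc⟩ := exists_eq_add_mul_add_mul a 0
  replace habc : a = x * b + y * c := by simpa [ha] using habc
  have hdiv : eval 0 (dx b + dy c) = 0 := by
    rw [habc, eval_zero_laplacian] at hΔ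
    exact (mul_eq_zero.1 hΔ).resolve_left two_ne_zero
  obtain ⟨h, hh⟩ := exists_v₁_eq hdiv
  have hX : coordinates.vectorFieldDifferential ellipticPoisson (h • v₁ - (b • dx + c • dy)) =
      (2 : ℝ) • a := by
    rw [map_sub, vectorFieldDifferential_smul_v₁, vectorFieldDifferential_apply, hh, two_smul]
    simp only [Derivation.coe_add, Derivation.coe_smul, Pi.add_apply, Pi.smul_apply, smul_eq_mul,
      dx_x, dx_y, dy_x, dy_y, mul_one, mul_zero, add_zero, zero_add, habc]
    ring
  exact ⟨(2⁻¹ : ℝ) • (h • v₁ - (b • dx + c • dy)), by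
    rw [map_smul, hX, inv_smul_smul₀ two_ne_zero]⟩

theorem range_vectorFieldDifferential :
    LinearMap.range (coordinates.vectorFieldDifferential ellipticPoisson) =
      LinearMap.ker valueLaplacianAtZero := by
  refine le_antisymm ?_ fun a ha => ?_
  · rintro _ ⟨X, rfl⟩
    exact vectorFieldDifferential_mem_ker X
  · obtain ⟨hvalue, hΔ⟩ := mem_ker_valueLaplacianAtZero.1 ha
    exact exists_vectorFieldDifferential_eq hvalue hΔ

/-- The isomorphism `H²_Π(ℝ²) ≅ ℝ²` for `Π = Π_E`. -/
def poissonCohomologyTwoEquiv : PoissonCohomology ellipticPoisson 2 ≃ₗ[ℝ] (Fin 2 → ℝ) :=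
  (coordinates.poissonCohomologyTwoEquiv ellipticPoisson).trans <|
    (Submodule.quotEquivOfEq _ _ range_vectorFieldDifferential).trans <|
    LinearMap.quotKerEquivOfSurjective _ valueLaplacianAtZero_surjective

end PoissonCohomology

end SmoothPlane

end

theorem mainTheorem5 :
    Nonempty (ECohomology SmoothPlane.elliptic 2 ≃ₗ[ℝ] ℝ) ∧
    Nonempty (PoissonCohomology SmoothPlane.ellipticPoisson 2 ≃ₗ[ℝ] (Fin 2 → ℝ)) ∧
    IsEmpty (ECohomology SmoothPlane.elliptic 2 ≃ₗ[ℝ]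
      PoissonCohomology SmoothPlane.ellipticPoisson 2) ∧
    ¬ ∀ k : ℕ, Nonempty (ECohomology SmoothPlane.elliptic k ≃ₗ[ℝ]
      PoissonCohomology SmoothPlane.ellipticPoisson k) := by
  have hdim : IsEmpty (ECohomology SmoothPlane.elliptic 2 ≃ₗ[ℝ]
      PoissonCohomology SmoothPlane.ellipticPoisson 2) := ⟨fun φ => by
    simpa using ((SmoothPlane.eCohomologyTwoEquiv.symm.trans φ).trans
      SmoothPlane.poissonCohomologyTwoEquiv).finrank_eq⟩
  exact ⟨⟨SmoothPlane.eCohomologyTwoEquiv⟩, ⟨SmoothPlane.poissonCohomologyTwoEquiv⟩, hdim,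
    fun hall => (hall 2).elim hdim.elim⟩
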